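/- Let $d \ge 1$ be an integer, let $x_0, x_1, \ldots, x_d$ be $d+1$ affinely independent points in $\mathbb{R}^d$, and let $\Delta$ be the $d$-simplex they span. For $1 \le p \le d$, let $\Delta_d^{(p)}$ be the hypersimplex of order $p$, that is, the convex hull of all sums of $p$ of the $d+1$ points (taken at distinct indices and considered as vectors), and let $v(d,p) = \mathrm{vol}_d(\Delta_d^{(p)}) / \mathrm{vol}_d(\Delta)$ be its relative volume. For $0 \le k \le d-1$, let the Eulerian number $A(d,k)$ be the number of permutations $j_1, \ldots, j_d$ of $1, \ldots, d$ with exactly $k$ descents, that is, with exactly $k$ indices $1 \le i \le d-1$ such that $j_i > j_{i+1}$. Then: 1. for every integer $n \ge 1$, $$\sum_{p=1}^{d} v(d,p) \binom{n+d-p}{n-p} = n^d ,$$ where $\binom{n+d-p}{n-p} = 0$ whenever $n-p < 0$; 2. $v(d,k+1) = A(d,k)$ for every integer $0 \le k \le d-1$. In particular, the relative volumes do not depend on the choice of the points. -/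

import Mathlib

namespace HypersimplexVolume

/-- The descents of a permutation of `d` letters (in zero-based indexing): the positions `i`
such that `i + 1` is also a position and `σ i > σ (i + 1)`. -/
def descents {d : ℕ} (σ : Equiv.Perm (Fin d)) : Finset (Fin d) :=
  {i | ∃ h : (i : ℕ) + 1 < d, σ ⟨(i : ℕ) + 1, h⟩ < σ i}

/-- The Eulerian number `A(d, k)`: the number of permutations of `d` letters with exactly `k`
descents. -/
def eulerianNumber (d k : ℕ) : ℕ :=
  Finset.card {σ : Equiv.Perm (Fin d) | (descents σ).card = k}

/-- The `p`-fold sums of the points `x 0, …, x d`: all sums of `p` of the `d + 1` points,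
viewed as vectors. -/
def foldSums {d : ℕ} (x : Fin (d + 1) → EuclideanSpace ℝ (Fin d)) (p : ℕ) :
    Set (EuclideanSpace ℝ (Fin d)) :=
  {y | ∃ s : Finset (Fin (d + 1)), s.card = p ∧ ∑ i ∈ s, x i = y}

/-- The hypersimplex of order `p` of the points `x 0, …, x d`: the convex hull of their
`p`-fold sums. -/
def hypersimplex {d : ℕ} (x : Fin (d + 1) → EuclideanSpace ℝ (Fin d)) (p : ℕ) :
    Set (EuclideanSpace ℝ (Fin d)) :=
  convexHull ℝ (foldSums x p)

/-- The relative volume of the order-`p` hypersimplex: its `d`-dimensional Lebesgue measure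
divided by that of the simplex spanned by `x 0, …, x d`. -/
noncomputable def relativeVolume {d : ℕ} (x : Fin (d + 1) → EuclideanSpace ℝ (Fin d))
    (p : ℕ) : ℝ :=
  MeasureTheory.volume.real (hypersimplex x p) /
    MeasureTheory.volume.real (convexHull ℝ (Set.range x))

end HypersimplexVolume

namespace HypersimplexVolume

/-! Both sequences, v(d,p) and A(d,p-1), satisfy the same linear system: for each n, their sum
against the given binomials is n^d. This system is unitriangular, so they agree
(`eq_of_sum_mul_choose_eq`). For Eulerian numbers the system is Worpitzky's identity (`worpitzky`),
obtained by classifying the n^d functions by their sorting permutation. For volumes, an affine map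
carries the slab p-1 ≤ ∑ t ≤ p of the unit cube onto the order-p hypersimplex
(`relativeVolume_eq_cubeSlab`). Cutting the n-fold dilate of the corner simplex along the integer
grid yields translates of these slabs up to null sets, and counting them gives the system
(`pow_mul_volume_cubeSlab_one`). -/

/-! ### Worpitzky's identity -/

theorem sort_eq_iff_succ {m n : ℕ} (f : Fin (m + 1) → Fin n) (σ : Equiv.Perm (Fin (m + 1))) :
    Tuple.sort f = σ ↔ ∀ i : Fin m, f (σ i.castSucc) < f (σ i.succ) ∨
      f (σ i.castSucc) = f (σ i.succ) ∧ σ i.castSucc < σ i.succ := by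
  rw [eq_comm, Tuple.eq_sort_iff', Fin.strictMono_iff_lt_succ]
  refine forall_congr' fun i => ?_
  rw [← Prod.Lex.toLex_lt_toLex (x := (f (σ i.castSucc), σ i.castSucc))
    (y := (f (σ i.succ), σ i.succ))]
  rfl

/-- The number of ascents of `σ` strictly before the position `i`. -/
def ascentsBefore {m : ℕ} (σ : Equiv.Perm (Fin (m + 1))) (i : Fin (m + 1)) : ℕ :=
  Finset.card {j : Fin m | j.castSucc < i ∧ σ j.castSucc < σ j.succ}

theorem ascentsBefore_zero {m : ℕ} (σ : Equiv.Perm (Fin (m + 1))) : ascentsBefore σ 0 = 0 := by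
  simp [ascentsBefore]

theorem ascentsBefore_succ {m : ℕ} (σ : Equiv.Perm (Fin (m + 1))) (i : Fin m) :
    ascentsBefore σ i.succ =
      ascentsBefore σ i.castSucc + if σ i.castSucc < σ i.succ then 1 else 0 := by
  unfold ascentsBefore
  split_ifs with h
  · rw [← Finset.card_insert_of_notMem (a := i) (by simp)]
    congr 1
    ext j
    simp only [Finset.mem_filter, Finset.mem_univ, true_and, Finset.mem_insert]
    constructor
    · rintro ⟨hj, hσ⟩
      rcases (Fin.castSucc_lt_succ_iff.1 hj).eq_or_lt with rfl | hlt
      · exact Or.inl rfl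
      · exact Or.inr ⟨hlt, hσ⟩
    · rintro (rfl | ⟨hj, hσ⟩)
      · exact ⟨Fin.castSucc_lt_succ, h⟩
      · exact ⟨hj.trans Fin.castSucc_lt_succ, hσ⟩
  · rw [add_zero]
    congr 1
    ext j
    simp only [Finset.mem_filter, Finset.mem_univ, true_and, and_congr_left_iff]
    intro hσ
    have hne : j ≠ i := by rintro rfl; exact h hσ
    rw [Fin.castSucc_lt_succ_iff, Fin.castSucc_lt_castSucc_iff]
    exact ⟨fun hle => lt_of_le_of_ne hle hne, le_of_lt⟩

theorem card_descents_eq {m : ℕ} (σ : Equiv.Perm (Fin (m + 1))) :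
    (descents σ).card = Finset.card {j : Fin m | ¬ σ j.castSucc < σ j.succ} := by
  rw [← Finset.card_map (s := {j : Fin m | ¬ σ j.castSucc < σ j.succ}) Fin.castSuccEmb]
  congr 1
  ext i
  simp only [descents, Finset.mem_filter, Finset.mem_univ, true_and, Finset.mem_map,
    Fin.castSuccEmb_apply]
  constructor
  · rintro ⟨h, hi⟩
    exact ⟨⟨i, by omega⟩, not_lt.2 hi.le, rfl⟩
  · rintro ⟨j, hj, rfl⟩
    refine ⟨by simp, lt_of_le_of_ne (not_lt.1 hj) fun h => ?_⟩
    exact absurd (σ.injective h) (Fin.castSucc_lt_succ (i := j)).ne'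

theorem ascentsBefore_last_add_card_descents {m : ℕ} (σ : Equiv.Perm (Fin (m + 1))) :
    ascentsBefore σ (Fin.last m) + (descents σ).card = m := by
  rw [card_descents_eq, ascentsBefore]
  simp only [Fin.castSucc_lt_last, true_and]
  simpa using Finset.card_filter_add_card_filter_not
    (s := (Finset.univ : Finset (Fin m))) (p := fun j => σ j.castSucc < σ j.succ)

/-- Sorting is stable, so `f ∘ σ` may repeat a value at an ascent of `σ` but must increase strictly
at a descent. Adding the number of ascents so far makes the sequence strictly increasing everywhere,
so it amounts to an (m+1)-subset of `range (n + asc)`. -/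
theorem card_sort_eq {m : ℕ} (n : ℕ) (σ : Equiv.Perm (Fin (m + 1))) :
    Finset.card {f : Fin (m + 1) → Fin n | Tuple.sort f = σ} =
      (n + ascentsBefore σ (Fin.last m)).choose (m + 1) := by
  rw [← Finset.card_range (n + ascentsBefore σ (Fin.last m)), ← Finset.card_powersetCard]
  have hmono : ∀ f : Fin (m + 1) → Fin n, Tuple.sort f = σ →
      StrictMono fun i => (f (σ i) : ℕ) + ascentsBefore σ i := by
    intro f hf
    rw [Fin.strictMono_iff_lt_succ]
    intro i
    have h := (sort_eq_iff_succ f σ).1 hf i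
    rw [ascentsBefore_succ]
    simp only [Fin.lt_def, Fin.ext_iff] at h ⊢
    split_ifs <;> omega
  refine Finset.card_bij
    (fun f _ => Finset.univ.image fun i => (f (σ i) : ℕ) + ascentsBefore σ i) ?_ ?_ ?_
  · intro f hf
    have hf := hmono f (by simpa using hf)
    rw [Finset.mem_powersetCard, Finset.card_image_of_injective _ hf.injective]
    refine ⟨fun k hk => ?_, by simp⟩
    obtain ⟨i, -, rfl⟩ := Finset.mem_image.1 hk
    have h1 := hf.monotone (Fin.le_last i)
    have h2 := (f (σ (Fin.last m))).2
    simp only [Finset.mem_range] at h1 ⊢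
    omega
  · intro f hf g hg hfg
    have hf := hmono f (by simpa using hf)
    have hg := hmono g (by simpa using hg)
    have := StrictMono.range_inj hf hg |>.1 (by
      have := congrArg (fun s : Finset ℕ => (s : Set ℕ)) hfg
      simpa using this)
    funext i
    have := congrFun this (σ.symm i)
    simp only [Equiv.apply_symm_apply, add_left_inj] at this
    exact Fin.ext this
  · intro S hS
    obtain ⟨hSr, hSc⟩ := Finset.mem_powersetCard.1 hS
    -- Inverse map: list `S` increasingly and subtract the ascent counts.
    set e := S.orderEmbOfFin hSc with he
    have hle : ∀ i, ascentsBefore σ i ≤ e i := by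
      intro i
      induction i using Fin.induction with
      | zero => simp [ascentsBefore_zero]
      | succ i ih =>
        have h1 := e.strictMono (Fin.castSucc_lt_succ (i := i))
        rw [ascentsBefore_succ]
        split_ifs <;> omega
    have hstep : ∀ i : Fin m, e i.castSucc - ascentsBefore σ i.castSucc +
        (if σ i.castSucc < σ i.succ then 0 else 1) ≤ e i.succ - ascentsBefore σ i.succ := by
      intro i
      have h1 := e.strictMono (Fin.castSucc_lt_succ (i := i))
      have h2 := hle i.castSucc
      rw [ascentsBefore_succ]
      split_ifs <;> omega
    have hm : Monotone fun i => e i - ascentsBefore σ i :=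
      Fin.monotone_iff_le_succ.2 fun i => le_trans (Nat.le_add_right _ _) (hstep i)
    have hlt : ∀ i, e i - ascentsBefore σ i < n := by
      intro i
      have h1 := hm (Fin.le_last i)
      have h2 := Finset.mem_range.1 (hSr (S.orderEmbOfFin_mem hSc (Fin.last m)))
      have h3 := hle (Fin.last m)
      simp only [← he] at h1 h2
      omega
    refine ⟨fun i => ⟨e (σ.symm i) - ascentsBefore σ (σ.symm i), hlt _⟩, ?_, ?_⟩
    · simp only [Finset.mem_filter, Finset.mem_univ, true_and]
      rw [sort_eq_iff_succ]
      intro i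
      have h := hstep i
      simp only [Equiv.symm_apply_apply, Fin.lt_def, Fin.ext_iff] at h ⊢
      split_ifs at h <;> omega
    · simp only [Equiv.symm_apply_apply]
      rw [← S.image_orderEmbOfFin_univ hSc]
      refine Finset.image_congr fun i _ => ?_
      exact Nat.sub_add_cancel (hle i)

/-- Worpitzky's identity. -/
theorem worpitzky {d : ℕ} (hd : 1 ≤ d) (n : ℕ) :
    ∑ p ∈ Finset.Icc 1 d, eulerianNumber d (p - 1) * (n + d - p).choose d = n ^ d := by
  obtain ⟨m, rfl⟩ : ∃ m, d = m + 1 := ⟨d - 1, by omega⟩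
  have h1 : n ^ (m + 1) = ∑ σ : Equiv.Perm (Fin (m + 1)),
      (n + (m + 1) - ((descents σ).card + 1)).choose (m + 1) := by
    calc n ^ (m + 1) = (Finset.univ : Finset (Fin (m + 1) → Fin n)).card := by simp
      _ = ∑ σ : Equiv.Perm (Fin (m + 1)),
          Finset.card {f : Fin (m + 1) → Fin n | Tuple.sort f = σ} :=
        Finset.card_eq_sum_card_fiberwise (by simp)
      _ = _ := by
        refine Finset.sum_congr rfl fun σ _ => ?_
        have := ascentsBefore_last_add_card_descents σ
        rw [card_sort_eq]
        congr 1
        omega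
  rw [h1, ← Finset.sum_fiberwise_of_maps_to (t := Finset.Icc 1 (m + 1))
    (g := fun σ => (descents σ).card + 1)]
  · refine Finset.sum_congr rfl fun p hp => ?_
    have hp := Finset.mem_Icc.1 hp
    rw [Finset.sum_congr rfl (g := fun _ => (n + (m + 1) - p).choose (m + 1))
      fun σ hσ => by rw [(Finset.mem_filter.1 hσ).2], Finset.sum_const, smul_eq_mul,
      eulerianNumber]
    congr 2
    ext σ
    simp only [Finset.mem_filter, Finset.mem_univ, true_and]
    omega
  · intro σ _
    have := ascentsBefore_last_add_card_descents σ
    exact Finset.mem_Icc.2 ⟨by omega, by omega⟩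

/-! ### Uniqueness for the linear system, and lattice point counts -/

/-- A triangular linear system with unit diagonal has at most one solution. -/
theorem eq_of_sum_mul_choose_eq {d : ℕ} {v w : ℕ → ℝ}
    (h : ∀ n, 1 ≤ n → ∑ p ∈ Finset.Icc 1 d, v p *
        (if p ≤ n then ((n + d - p).choose (n - p) : ℝ) else 0) =
      ∑ p ∈ Finset.Icc 1 d, w p *
        (if p ≤ n then ((n + d - p).choose (n - p) : ℝ) else 0))
    {n : ℕ} (hn : n ∈ Finset.Icc 1 d) : v n = w n := by
  induction n using Nat.strong_induction_on with
  | _ n ih =>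
    have hn' := Finset.mem_Icc.1 hn
    have h := h n hn'.1
    rw [← Finset.add_sum_erase _ _ hn, ← Finset.add_sum_erase _ _ hn] at h
    rw [Finset.sum_congr rfl (g := fun p => w p *
        (if p ≤ n then ((n + d - p).choose (n - p) : ℝ) else 0))] at h
    · simpa using h
    · intro p hp
      obtain ⟨hpn, hp⟩ := Finset.mem_erase.1 hp
      by_cases hle : p ≤ n
      · rw [ih p (lt_of_le_of_ne hle hpn) hp]
      · simp [hle]

theorem sum_eulerianNumber_mul {d : ℕ} (hd : 1 ≤ d) (n : ℕ) :
    ∑ p ∈ Finset.Icc 1 d, (eulerianNumber d (p - 1) : ℝ) *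
        (if p ≤ n then ((n + d - p).choose (n - p) : ℝ) else 0) = (n : ℝ) ^ d := by
  have h := congrArg (Nat.cast : ℕ → ℝ) (worpitzky hd n)
  push_cast at h
  rw [← h]
  refine Finset.sum_congr rfl fun p hp => ?_
  have hp := Finset.mem_Icc.1 hp
  split_ifs with hpn
  · rw [← Nat.choose_symm_of_eq_add (show n + d - p = d + (n - p) by omega)]
  -- For p > n the top entry n + d - p is below d, so Worpitzky's coefficient vanishes too.
  · rw [Nat.choose_eq_zero_of_lt (by omega), Nat.cast_zero]

/-- Stars and bars with the slack `m - ∑ a i` as an extra coordinate. The bound `N` only makes the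
box finite. -/
theorem card_sum_le (d m N : ℕ) (hN : m ≤ N) :
    Finset.card {a ∈ Fintype.piFinset fun _ : Fin d => Finset.range (N + 1) | ∑ i, a i ≤ m} =
      (m + d).choose m := by
  have h := Finset.card_finsuppAntidiag_nat_eq_choose (s := (Finset.univ : Finset (Fin (d + 1)))) m
  rw [Finset.card_univ, Fintype.card_fin, show d + 1 + m - 1 = m + d by omega] at h
  rw [← h]
  refine Finset.card_bij'
    (fun a _ => Finsupp.equivFunOnFinite.symm (Fin.cons (m - ∑ i, a i) a))
    (fun b _ i => b i.succ) ?_ ?_ ?_ ?_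
  · intro a ha
    simp only [Finset.mem_filter] at ha
    simp [Finset.mem_finsuppAntidiag, Fin.sum_univ_succ, ha.2]
  · intro b hb
    simp only [Finset.mem_finsuppAntidiag, Fin.sum_univ_succ] at hb
    simp only [Finset.mem_filter, Fintype.mem_piFinset, Finset.mem_range]
    refine ⟨fun i => ?_, by omega⟩
    have := Finset.single_le_sum (f := fun i : Fin d => b i.succ) (fun _ _ => Nat.zero_le _)
      (Finset.mem_univ i)
    omega
  · intro a ha
    funext i
    simp
  · intro b hb
    simp only [Finset.mem_finsuppAntidiag, Fin.sum_univ_succ] at hb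
    ext i
    refine Fin.cases ?_ (fun i => ?_) i
    · simp; omega
    · simp

/-! ### Volumes of cube slabs -/

open MeasureTheory Set
open scoped Pointwise

/-- The slab `{t ∈ [0, 1]^d : p - 1 ≤ ∑ t i ≤ p}` of the unit cube. -/
def cubeSlab (d p : ℕ) : Set (Fin d → ℝ) :=
  {t | (∀ i, t i ∈ Icc (0 : ℝ) 1) ∧ (p : ℝ) - 1 ≤ ∑ i, t i ∧ ∑ i, t i ≤ p}

/-- The part `{t ∈ [0, 1)^d : ∑ t i ≤ c}` of the half-open unit cube. -/
def cubeCorner (d : ℕ) (c : ℝ) : Set (Fin d → ℝ) :=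
  {t | (∀ i, t i ∈ Ico (0 : ℝ) 1) ∧ ∑ i, t i ≤ c}

/-- The corner simplex `{t ≥ 0 : ∑ t i ≤ c}`. -/
def cornerSimplex (d : ℕ) (c : ℝ) : Set (Fin d → ℝ) :=
  {t | (∀ i, 0 ≤ t i) ∧ ∑ i, t i ≤ c}

theorem cubeSlab_one (d : ℕ) : cubeSlab d 1 = cornerSimplex d 1 := by
  ext t
  simp only [cubeSlab, cornerSimplex, mem_ofPred_eq, mem_Icc, Nat.cast_one, sub_self]
  constructor
  · rintro ⟨h1, -, h2⟩
    exact ⟨fun i => (h1 i).1, h2⟩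
  · rintro ⟨h1, h2⟩
    exact ⟨fun i => ⟨h1 i, (Finset.single_le_sum (fun j _ => h1 j) (Finset.mem_univ i)).trans h2⟩,
      Finset.sum_nonneg fun i _ => h1 i, h2⟩

theorem measurableSet_cubeCorner (d : ℕ) (c : ℝ) : MeasurableSet (cubeCorner d c) := by
  have : cubeCorner d c = (univ.pi fun _ => Ico (0 : ℝ) 1) ∩ {t | ∑ i, t i ≤ c} := by
    ext t; simp [cubeCorner]
  rw [this]
  exact (MeasurableSet.univ_pi fun _ => measurableSet_Ico).inter
    (measurableSet_le (by fun_prop) measurable_const)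

theorem volume_cubeSlab_ne_top (d p : ℕ) : volume (cubeSlab d p) ≠ ⊤ := by
  refine ((measure_mono (t := Icc (0 : Fin d → ℝ) 1) fun t ht => ?_).trans_lt
    isCompact_Icc.measure_lt_top).ne
  exact ⟨fun i => (ht.1 i).1, fun i => (ht.1 i).2⟩

theorem volume_sum_eq_const {d : ℕ} (hd : 1 ≤ d) (c : ℝ) :
    volume {t : Fin d → ℝ | ∑ i, t i = c} = 0 := by
  set φ : (Fin d → ℝ) →ₗ[ℝ] ℝ := ∑ i, LinearMap.proj i with hφ
  have hφt : ∀ t, φ t = ∑ i, t i := fun t => by simp [hφ, LinearMap.sum_apply]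
  have hset : {t : Fin d → ℝ | ∑ i, t i = c} =
      (fun t => t + fun _ => -(c / d)) ⁻¹' (LinearMap.ker φ : Set (Fin d → ℝ)) := by
    ext t
    have hd' : (d : ℝ) ≠ 0 := by positivity
    simp only [mem_ofPred_eq, mem_preimage, SetLike.mem_coe, LinearMap.mem_ker, hφt, Pi.add_apply,
      Finset.sum_add_distrib, Finset.sum_const, Finset.card_univ, Fintype.card_fin, nsmul_eq_mul]
    rw [mul_neg, mul_div_cancel₀ _ hd', ← sub_eq_add_neg, sub_eq_zero]
  rw [hset, measure_preimage_add_right]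
  refine Measure.addHaar_submodule _ _ fun h => ?_
  have h1 : (fun _ => 1 : Fin d → ℝ) ∈ LinearMap.ker φ := h ▸ Submodule.mem_top
  rw [LinearMap.mem_ker, hφt] at h1
  simp at h1
  omega

theorem volume_cubeSlab_pos {d : ℕ} (hd : 1 ≤ d) : 0 < volume (cubeSlab d 1) := by
  have hd' : (0 : ℝ) < d := by positivity
  have hsub : (univ.pi fun _ => Ioo (0 : ℝ) (1 / d)) ⊆ cubeSlab d 1 := by
    intro t ht
    rw [cubeSlab_one]
    have ht : ∀ i, 0 < t i ∧ t i < 1 / d := fun i => ht i (mem_univ i)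
    refine ⟨fun i => (ht i).1.le, ?_⟩
    calc ∑ i, t i ≤ ∑ _i : Fin d, 1 / (d : ℝ) := Finset.sum_le_sum fun i _ => (ht i).2.le
      _ = 1 := by simp [hd'.ne']
  refine lt_of_lt_of_le ?_ (measure_mono hsub)
  rw [volume_pi_pi]
  simp [Real.volume_Ioo, ENNReal.pow_pos, hd']

theorem volume_cubeSlab_of_lt {d p : ℕ} (hd : 1 ≤ d) (hp : d < p) : volume (cubeSlab d p) = 0 := by
  refine measure_mono_null (fun t ht => ?_) (volume_sum_eq_const hd d)
  refine le_antisymm ?_ ?_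
  · calc ∑ i, t i ≤ ∑ _i : Fin d, (1 : ℝ) := Finset.sum_le_sum fun i _ => (ht.1 i).2
      _ = d := by simp
  · have h1 : ((d + 1 : ℕ) : ℝ) ≤ p := by exact_mod_cast hp
    have h2 := ht.2.1
    push_cast at h1
    linarith

/-- Consecutive slabs meet in a hyperplane ∑ t = m, and the half-open and closed cubes differ by a
null set. -/
theorem volume_cubeCorner_nat {d : ℕ} (hd : 1 ≤ d) (m : ℕ) :
    volume (cubeCorner d m) = ∑ p ∈ Finset.Icc 1 m, volume (cubeSlab d p) := by
  induction m with
  | zero =>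
    simp only [Finset.Icc_eq_empty_of_lt zero_lt_one, Finset.sum_empty]
    refine measure_mono_null (fun t ht => ?_) (volume_sum_eq_const hd 0)
    exact le_antisymm (by simpa using ht.2) (Finset.sum_nonneg fun i _ => (ht.1 i).1)
  | succ m ih =>
    rw [Finset.sum_Icc_succ_top (by omega), ← ih,
      ← measure_inter_add_sdiff (cubeCorner d (m + 1 : ℕ)) (measurableSet_cubeCorner d m)]
    congr 1
    · congr 1
      refine inter_eq_right.2 fun t ht => ⟨ht.1, ht.2.trans ?_⟩
      push_cast
      linarith
    · have hcube : ∀ᵐ t : Fin d → ℝ,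
          (∀ i, t i ∈ Ico (0 : ℝ) 1) ↔ ∀ i, t i ∈ Icc (0 : ℝ) 1 := by
        have h := Measure.univ_pi_Ico_ae_eq_Icc (μ := fun _ : Fin d => (volume : Measure ℝ))
          (f := fun _ => 0) (g := fun _ => 1)
        rw [← pi_univ_Icc] at h
        filter_upwards [Filter.eventuallyEq_set.1 h] with t ht
        simpa only [mem_univ_pi] using ht
      refine measure_congr ?_
      have hplane : ∀ᵐ t : Fin d → ℝ, ∑ i, t i ≠ m := by
        simpa [ae_iff] using volume_sum_eq_const hd m
      refine Filter.eventuallyEq_set.2 ?_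
      filter_upwards [hcube, hplane] with t ht htm
      simp only [cubeCorner, cubeSlab, mem_sdiff, mem_ofPred_eq, ht]
      push_cast
      rw [add_sub_cancel_right]
      constructor
      · rintro ⟨⟨h1, h2⟩, h3⟩
        exact ⟨h1, (not_le.1 fun h => h3 ⟨h1, h⟩).le, h2⟩
      · rintro ⟨h1, h2, h3⟩
        exact ⟨⟨h1, h3⟩, fun h => htm (le_antisymm h.2 h2)⟩

/-- The fibres of the coordinatewise floor partition the simplex; translating the fibre over `a` to
the origin lowers the bound on the coordinate sum to `n - ∑ a i`. -/
theorem volume_cornerSimplex_eq_sum_cubeCorner (d n : ℕ) :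
    volume (cornerSimplex d n) =
      ∑ a ∈ (Fintype.piFinset fun _ : Fin d => Finset.range (n + 1)).filter (∑ i, · i ≤ n),
        volume (cubeCorner d ((n - ∑ i, a i : ℕ) : ℝ)) := by
  set A := (Fintype.piFinset fun _ : Fin d => Finset.range (n + 1)).filter (∑ i, · i ≤ n) with hA
  set fl : (Fin d → ℝ) → Fin d → ℕ := fun t i => ⌊t i⌋₊ with hfl
  have hmeas : Measurable fl := measurable_pi_lambda _ fun i =>
    Nat.measurable_floor.comp (measurable_pi_apply i)
  have hmaps : cornerSimplex d n ⊆ fl ⁻¹' A := by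
    intro t ht
    have hs : ∑ i, ⌊t i⌋₊ ≤ n := by
      have : ((∑ i, ⌊t i⌋₊ : ℕ) : ℝ) ≤ n := by
        push_cast
        exact (Finset.sum_le_sum fun i _ => Nat.floor_le (ht.1 i)).trans ht.2
      exact_mod_cast this
    simp only [hA, hfl, mem_preimage, Finset.coe_filter, mem_ofPred_eq, Fintype.mem_piFinset,
      Finset.mem_range]
    refine ⟨fun i => Nat.lt_succ_of_le (le_trans ?_ hs), hs⟩
    exact Finset.single_le_sum (f := fun i => ⌊t i⌋₊) (fun _ _ => Nat.zero_le _)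
      (Finset.mem_univ i)
  have h1 := sum_measure_preimage_singleton (μ := volume.restrict (cornerSimplex d n)) A
    (f := fl) fun a _ => hmeas (measurableSet_singleton a)
  rw [Measure.restrict_apply (hmeas A.measurableSet), inter_eq_right.2 hmaps] at h1
  rw [← h1]
  refine Finset.sum_congr rfl fun a ha => ?_
  rw [Measure.restrict_apply (hmeas (measurableSet_singleton a)),
    ← measure_preimage_add_right volume (fun i => (a i : ℝ))]
  congr 1
  ext t
  have han : ∑ i, a i ≤ n := (Finset.mem_filter.1 ha).2
  simp only [mem_preimage, mem_inter_iff, mem_singleton_iff, cornerSimplex, cubeCorner,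
    mem_ofPred_eq, hfl, funext_iff, Pi.add_apply, Finset.sum_add_distrib]
  rw [Nat.cast_sub han, Nat.cast_sum]
  constructor
  · rintro ⟨hf, h0, hs⟩
    refine ⟨fun i => ?_, by linarith⟩
    have := (Nat.floor_eq_iff (h0 i)).1 (hf i)
    exact ⟨by linarith [this.1], by linarith [this.2]⟩
  · rintro ⟨h0, hs⟩
    have h0' : ∀ i, 0 ≤ t i + a i := fun i => add_nonneg (h0 i).1 (Nat.cast_nonneg _)
    refine ⟨fun i => (Nat.floor_eq_iff (h0' i)).2 ?_, h0', by linarith⟩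
    exact ⟨by linarith [(h0 i).1], by linarith [(h0 i).2]⟩

theorem volume_cornerSimplex_nat {d : ℕ} (n : ℕ) (hn : 1 ≤ n) :
    volume (cornerSimplex d n) = (n : ENNReal) ^ d * volume (cornerSimplex d 1) := by
  have hn' : (0 : ℝ) < n := by positivity
  have : cornerSimplex d n = (n : ℝ) • cornerSimplex d 1 := by
    ext t
    rw [mem_smul_set_iff_inv_smul_mem₀ hn'.ne']
    simp only [cornerSimplex, mem_ofPred_eq, Pi.smul_apply, smul_eq_mul, ← Finset.mul_sum]
    rw [inv_mul_le_iff₀ hn', mul_one]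
    simp [hn']
  rw [this, Measure.addHaar_smul_of_nonneg _ hn'.le]
  congr 1
  rw [Module.finrank_fin_fun, ENNReal.ofReal_pow hn'.le, ENNReal.ofReal_natCast]

theorem pow_mul_volume_cubeSlab_one {d : ℕ} (hd : 1 ≤ d) (n : ℕ) (hn : 1 ≤ n) :
    (n : ENNReal) ^ d * volume (cubeSlab d 1) = ∑ p ∈ Finset.Icc 1 n,
      volume (cubeSlab d p) * ((n + d - p).choose (n - p) : ENNReal) := by
  rw [cubeSlab_one, ← volume_cornerSimplex_nat n hn, volume_cornerSimplex_eq_sum_cubeCorner]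
  simp only [volume_cubeCorner_nat hd]
  -- Slab p occurs in the cell of `a` exactly when ∑ a ≤ n - p.
  rw [Finset.sum_comm' (t' := Finset.Icc 1 n)
    (s' := fun p => (Fintype.piFinset fun _ : Fin d => Finset.range (n + 1)).filter
      (∑ i, · i ≤ n - p))]
  · refine Finset.sum_congr rfl fun p hp => ?_
    have hp := Finset.mem_Icc.1 hp
    rw [Finset.sum_const, card_sum_le d (n - p) n (Nat.sub_le _ _), nsmul_eq_mul, mul_comm,
      show n - p + d = n + d - p by omega]
  · intro a p
    simp only [Finset.mem_filter, Finset.mem_Icc]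
    constructor
    · rintro ⟨⟨h1, h2⟩, h3, h4⟩
      exact ⟨⟨h1, by omega⟩, by omega, by omega⟩
    · rintro ⟨⟨h1, h2⟩, h3, h4⟩
      exact ⟨⟨h1, by omega⟩, by omega, by omega⟩

theorem sum_volume_cubeSlab_div {d : ℕ} (hd : 1 ≤ d) (n : ℕ) (hn : 1 ≤ n) :
    ∑ p ∈ Finset.Icc 1 d, volume.real (cubeSlab d p) / volume.real (cubeSlab d 1) *
      (if p ≤ n then ((n + d - p).choose (n - p) : ℝ) else 0) = (n : ℝ) ^ d := by
  have hpos : 0 < volume.real (cubeSlab d 1) :=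
    ENNReal.toReal_pos (volume_cubeSlab_pos hd).ne' (volume_cubeSlab_ne_top d 1)
  have h := congrArg ENNReal.toReal (pow_mul_volume_cubeSlab_one hd n hn)
  rw [ENNReal.toReal_sum fun p _ =>
    ENNReal.mul_ne_top (volume_cubeSlab_ne_top d p) (ENNReal.natCast_ne_top _)] at h
  simp only [ENNReal.toReal_mul, ENNReal.toReal_pow, ENNReal.toReal_natCast, ← measureReal_def]
    at h
  rw [eq_comm, ← mul_left_inj' hpos.ne', h, Finset.sum_mul]
  have hterm : ∀ p, volume.real (cubeSlab d p) / volume.real (cubeSlab d 1) *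
      (if p ≤ n then ((n + d - p).choose (n - p) : ℝ) else 0) * volume.real (cubeSlab d 1) =
      if p ≤ n then volume.real (cubeSlab d p) * ((n + d - p).choose (n - p) : ℝ) else 0 := by
    intro p
    split_ifs
    · field_simp
    · simp
  simp only [hterm, ← Finset.sum_filter]
  symm
  -- The ranges p ≤ n and p ≤ d are reconciled because slabs with p > d are null.
  refine Finset.sum_subset (fun p hp => ?_) fun p hp hp' => ?_
  · simp only [Finset.mem_filter, Finset.mem_Icc] at hp ⊢
    omega
  · simp only [Finset.mem_filter, Finset.mem_Icc] at hp hp'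
    rw [measureReal_def, volume_cubeSlab_of_lt hd (by omega), ENNReal.toReal_zero, zero_mul]

/-! ### Vertices of the cube slice -/

/-- The slice `{t ∈ [0, 1]^ι : ∑ t i = p}` of the unit cube. -/
def cubeSlice (ι : Type*) [Fintype ι] (p : ℕ) : Set (ι → ℝ) :=
  {t | (∀ i, t i ∈ Icc (0 : ℝ) 1) ∧ ∑ i, t i = p}

/-- The 0/1-vectors with exactly `p` coordinates equal to `1`. -/
def indicatorVectors (ι : Type*) (p : ℕ) : Set (ι → ℝ) :=
  {t | ∃ s : Finset ι, s.card = p ∧ (s : Set ι).indicator 1 = t}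

theorem convex_cubeSlice (ι : Type*) [Fintype ι] (p : ℕ) : Convex ℝ (cubeSlice ι p) := by
  rintro t ⟨ht, hts⟩ u ⟨hu, hus⟩ a b ha hb hab
  refine ⟨fun i => convex_Icc 0 1 (ht i) (hu i) ha hb hab, ?_⟩
  simp only [Pi.add_apply, Pi.smul_apply, smul_eq_mul, Finset.sum_add_distrib, ← Finset.mul_sum,
    hts, hus]
  rw [← add_mul, hab, one_mul]

theorem isCompact_cubeSlice (ι : Type*) [Fintype ι] (p : ℕ) : IsCompact (cubeSlice ι p) := by
  have : cubeSlice ι p = (univ.pi fun _ => Icc (0 : ℝ) 1) ∩ {t | ∑ i, t i = p} := by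
    ext t; simp [cubeSlice, Pi.le_def, forall_and]
  rw [this]
  exact (isCompact_univ_pi fun _ => isCompact_Icc).inter_right
    (isClosed_eq (by fun_prop) continuous_const)

theorem indicatorVectors_subset_cubeSlice (ι : Type*) [Fintype ι] (p : ℕ) :
    indicatorVectors ι p ⊆ cubeSlice ι p := by
  classical
  rintro _ ⟨s, hs, rfl⟩
  refine ⟨fun i => ?_, ?_⟩
  · by_cases hi : i ∈ s <;> simp [hi]
  · simp [Set.indicator_apply, hs]

theorem finite_indicatorVectors (ι : Type*) [Finite ι] (p : ℕ) :
    (indicatorVectors ι p).Finite :=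
  (finite_range fun s : Finset ι => (s : Set ι).indicator (1 : ι → ℝ)).subset
    fun _ ⟨s, _, hs⟩ => ⟨s, hs⟩

/-- If all other coordinates were 0 or 1, the integrality of the sum would force `t i` to be an
integer. -/
theorem exists_ne_mem_Ioo {ι : Type*} [Fintype ι] {p : ℕ} {t : ι → ℝ} (ht : t ∈ cubeSlice ι p)
    {i : ι} (hi : t i ∈ Ioo (0 : ℝ) 1) : ∃ j, j ≠ i ∧ t j ∈ Ioo (0 : ℝ) 1 := by
  classical
  by_contra! h
  have h01 : ∀ j ∈ Finset.univ.erase i, t j = ((if t j = 1 then 1 else 0 : ℤ) : ℝ) := by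
    intro j hj
    have hj' := h j (Finset.ne_of_mem_erase hj)
    have h2 := ht.1 j
    split_ifs with h1
    · simp [h1]
    · rw [Int.cast_zero]
      by_contra h0
      exact hj' ⟨lt_of_le_of_ne h2.1 (Ne.symm h0), lt_of_le_of_ne h2.2 h1⟩
  have hs := ht.2
  rw [← Finset.add_sum_erase _ _ (Finset.mem_univ i), Finset.sum_congr rfl h01,
    ← Int.cast_sum] at hs
  set z := ∑ j ∈ Finset.univ.erase i, (if t j = 1 then 1 else 0 : ℤ)
  have hti : t i = ((p - z : ℤ) : ℝ) := by push_cast; linarith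
  rw [hti] at hi
  have h1 : 0 < (p - z : ℤ) := by exact_mod_cast hi.1
  have h2 : (p - z : ℤ) < 1 := by exact_mod_cast hi.2
  omega

theorem extremePoints_cubeSlice_subset (ι : Type*) [Fintype ι] (p : ℕ) :
    (cubeSlice ι p).extremePoints ℝ ⊆ indicatorVectors ι p := by
  classical
  intro t ht
  rw [mem_extremePoints] at ht
  obtain ⟨htm, hext⟩ := ht
  have h01 : ∀ i, t i = 0 ∨ t i = 1 := by
    intro i
    by_contra! hne
    have hi : t i ∈ Ioo (0 : ℝ) 1 :=
      ⟨lt_of_le_of_ne (htm.1 i).1 hne.1.symm, lt_of_le_of_ne (htm.1 i).2 hne.2⟩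
    obtain ⟨j, hji, hj⟩ := exists_ne_mem_Ioo htm hi
    -- Moving mass ±ε between coordinates `i` and `j` keeps the sum, and ε is small enough to stay
    -- in the cube; so `t` is a midpoint and not extreme.
    obtain ⟨ε, hε0, hε⟩ := exists_between
      (lt_min (lt_min hi.1 (sub_pos.2 hi.2)) (lt_min hj.1 (sub_pos.2 hj.2)))
    simp only [lt_min_iff] at hε
    obtain ⟨⟨hi0, hi1⟩, hj0, hj1⟩ := hε
    set v : ι → ℝ := Pi.single i ε - Pi.single j ε with hv
    have hvi : v i = ε := by simp [hv, hji.symm]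
    have hvj : v j = -ε := by simp [hv, hji]
    have hvk : ∀ k, k ≠ i → k ≠ j → v k = 0 := fun k h1 h2 => by simp [hv, h1, h2]
    have hvs : ∑ k, v k = 0 := by simp [hv]
    have hmem : ∀ s : ℝ, |s| ≤ 1 → t + s • v ∈ cubeSlice ι p := by
      intro s hs
      rw [abs_le] at hs
      refine ⟨fun k => ?_, ?_⟩
      · simp only [Pi.add_apply, Pi.smul_apply, smul_eq_mul, mem_Icc]
        by_cases hki : k = i
        · subst hki
          rw [hvi]
          constructor <;> nlinarith
        by_cases hkj : k = j
        · subst hkj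
          rw [hvj]
          constructor <;> nlinarith
        rw [hvk k hki hkj, mul_zero, add_zero]
        exact htm.1 k
      · simp only [Pi.add_apply, Pi.smul_apply, smul_eq_mul, Finset.sum_add_distrib,
          ← Finset.mul_sum, hvs, mul_zero, add_zero]
        exact htm.2
    have := (hext _ (hmem 1 (by simp)) _ (hmem (-1) (by simp))
      ⟨1 / 2, 1 / 2, by norm_num, by norm_num, by norm_num, by
        ext k
        simp only [Pi.add_apply, Pi.smul_apply, smul_eq_mul]
        ring⟩).1
    have := congrFun this i
    simp only [Pi.add_apply, Pi.smul_apply, smul_eq_mul, hvi] at this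
    linarith
  have hind : ((Finset.univ.filter fun i => t i = 1 : Finset ι) : Set ι).indicator 1 = t := by
    funext i
    rcases h01 i with h | h <;> simp [h]
  refine ⟨_, ?_, hind⟩
  have hs := htm.2
  rw [← hind] at hs
  simp only [Set.indicator_apply, Finset.mem_coe, Pi.one_apply, Finset.sum_ite_mem,
    Finset.univ_inter, Finset.sum_const, nsmul_eq_mul, mul_one] at hs
  exact_mod_cast hs

theorem convexHull_indicatorVectors (ι : Type*) [Fintype ι] (p : ℕ) :
    convexHull ℝ (indicatorVectors ι p) = cubeSlice ι p := by
  refine Subset.antisymm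
    (convexHull_min (indicatorVectors_subset_cubeSlice ι p) (convex_cubeSlice ι p)) ?_
  -- Krein–Milman; the hull of finitely many points is already closed.
  rw [← closure_convexHull_extremePoints (isCompact_cubeSlice ι p) (convex_cubeSlice ι p)]
  exact closure_minimal (convexHull_mono (extremePoints_cubeSlice_subset ι p))
    ((finite_indicatorVectors ι p).isClosed_convexHull ℝ)

/-! ### Hypersimplices as affine images of slabs -/

variable {d : ℕ} (x : Fin (d + 1) → EuclideanSpace ℝ (Fin d))

theorem hypersimplex_eq_image_cubeSlice (p : ℕ) :
    hypersimplex x p = Fintype.linearCombination ℝ x '' cubeSlice (Fin (d + 1)) p := by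
  rw [← convexHull_indicatorVectors, LinearMap.image_convexHull, hypersimplex]
  congr 1
  ext y
  have hsum : ∀ s : Finset (Fin (d + 1)),
      Fintype.linearCombination ℝ x ((s : Set (Fin (d + 1))).indicator 1) = ∑ i ∈ s, x i := by
    intro s
    simp [Fintype.linearCombination_apply, Set.indicator_apply, ite_smul]
  constructor
  · rintro ⟨s, hs, rfl⟩
    exact ⟨_, ⟨s, hs, rfl⟩, hsum s⟩
  · rintro ⟨_, ⟨s, hs, rfl⟩, rfl⟩
    exact ⟨s, hs, (hsum s).symm⟩

theorem convexHull_range_eq_hypersimplex_one : convexHull ℝ (range x) = hypersimplex x 1 := by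
  rw [hypersimplex]
  congr 1
  ext y
  constructor
  · rintro ⟨i, rfl⟩
    exact ⟨{i}, by simp⟩
  · rintro ⟨s, hs, rfl⟩
    obtain ⟨i, rfl⟩ := Finset.card_eq_one.1 hs
    exact ⟨i, by simp⟩

/-- Eliminate the coordinate at `x 0`: it equals p minus the sum of the others, and its confinement
to [0, 1] is the slab condition. -/
theorem hypersimplex_eq_vadd_image_cubeSlab (p : ℕ) :
    hypersimplex x p = ((p : ℝ) • x 0) +ᵥ
      Fintype.linearCombination ℝ (fun i : Fin d => x i.succ - x 0) '' cubeSlab d p := by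
  rw [hypersimplex_eq_image_cubeSlice]
  have key : ∀ t : Fin (d + 1) → ℝ, ∑ i, t i = p → Fintype.linearCombination ℝ x t =
      (p : ℝ) • x 0 + Fintype.linearCombination ℝ (fun i : Fin d => x i.succ - x 0)
        (fun i => t i.succ) := by
    intro t ht
    rw [← ht]
    simp only [Fintype.linearCombination_apply, Fin.sum_univ_succ, smul_sub,
      Finset.sum_sub_distrib, add_smul, Finset.sum_smul]
    abel
  ext y
  simp only [mem_vadd_set, mem_image, exists_exists_and_eq_and, vadd_eq_add]
  constructor
  · rintro ⟨t, ⟨h1, h2⟩, rfl⟩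
    refine ⟨fun i => t i.succ, ⟨fun i => h1 _, ?_⟩, (key t h2).symm⟩
    rw [Fin.sum_univ_succ] at h2
    have := h1 0
    constructor <;> linarith [this.1, this.2]
  · rintro ⟨t, ⟨h1, h2, h3⟩, rfl⟩
    have hs : ∑ i, (Fin.cons (p - ∑ i, t i) t : Fin (d + 1) → ℝ) i = p := by
      simp [Fin.sum_univ_succ]
    refine ⟨Fin.cons (p - ∑ i, t i) t, ⟨fun i => ?_, hs⟩, by simpa using key _ hs⟩
    refine Fin.cases ?_ (fun i => ?_) i
    · rw [Fin.cons_zero]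
      exact ⟨by linarith, by linarith⟩
    · exact h1 i

/-- The linear equivalence sending the standard basis to the edge vectors at `x 0`. -/
noncomputable def edgeEquiv (hx : AffineIndependent ℝ x) :
    (Fin d → ℝ) ≃L[ℝ] EuclideanSpace ℝ (Fin d) :=
  LinearEquiv.toContinuousLinearEquiv <|
    LinearEquiv.ofInjectiveOfFinrankEq
      (Fintype.linearCombination ℝ fun i : Fin d => x i.succ - x 0)
      (by
        have h := (affineIndependent_iff_linearIndependent_vsub ℝ x 0).1 hx
        have h := h.comp (fun i : Fin d => (⟨i.succ, Fin.succ_ne_zero i⟩ : {j : Fin (d + 1) // j ≠ 0}))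
          fun i j hij => Fin.succ_injective _ (congrArg Subtype.val hij)
        exact LinearIndependent.fintypeLinearCombination_injective h)
      (by simp)

theorem relativeVolume_eq_cubeSlab (hx : AffineIndependent ℝ x) (p : ℕ) :
    relativeVolume x p = volume.real (cubeSlab d p) / volume.real (cubeSlab d 1) := by
  set e := edgeEquiv x hx
  -- `ν` measures a set by the volume of its image under `e`. By uniqueness of Haar measure it is a
  -- constant multiple of volume, and the constant cancels in the ratio.
  set ν : Measure (Fin d → ℝ) := Measure.map e.symm volume with hν
  set c := Measure.addHaarScalarFactor ν volume
  have hνc : ν = c • volume := Measure.isAddLeftInvariant_eq_smul ν volume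
  have hvol : ∀ q, volume.real (hypersimplex x q) = c * volume.real (cubeSlab d q) := by
    intro q
    have h1 : hypersimplex x q = ((q : ℝ) • x 0) +ᵥ (e '' cubeSlab d q) :=
      hypersimplex_eq_vadd_image_cubeSlab x q
    have h2 : volume (e '' cubeSlab d q) = ν (cubeSlab d q) := by
      refine Eq.trans ?_ (e.symm.toHomeomorph.toMeasurableEquiv.map_apply _).symm
      congr 1
      exact e.toEquiv.image_eq_preimage_symm _
    rw [measureReal_def, h1, measure_vadd, h2, hνc, Measure.smul_apply, ENNReal.smul_def,
      smul_eq_mul, ENNReal.toReal_mul, ENNReal.coe_toReal, measureReal_def]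
  have hc0 : (c : ℝ) ≠ 0 := by
    have : 0 < c := Measure.addHaarScalarFactor_pos_of_isAddHaarMeasure ν volume
    exact_mod_cast this.ne'
  rw [relativeVolume, convexHull_range_eq_hypersimplex_one, hvol, hvol,
    mul_div_mul_left _ _ hc0]

end HypersimplexVolume

theorem theorem4p5 (d : ℕ) (hd : 1 ≤ d)
    (x : Fin (d + 1) → EuclideanSpace ℝ (Fin d)) (hx : AffineIndependent ℝ x) :
    (∀ n : ℕ, 1 ≤ n →
      ∑ p ∈ Finset.Icc 1 d, HypersimplexVolume.relativeVolume x p *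
        (if p ≤ n then ((n + d - p).choose (n - p) : ℝ) else 0) = (n : ℝ) ^ d) ∧
    (∀ k : ℕ, k < d →
      HypersimplexVolume.relativeVolume x (k + 1) =
        (HypersimplexVolume.eulerianNumber d k : ℝ)) := by
  have h : ∀ n : ℕ, 1 ≤ n →
      ∑ p ∈ Finset.Icc 1 d, HypersimplexVolume.relativeVolume x p *
        (if p ≤ n then ((n + d - p).choose (n - p) : ℝ) else 0) = (n : ℝ) ^ d := by
    intro n hn
    simp only [HypersimplexVolume.relativeVolume_eq_cubeSlab x hx]
    exact HypersimplexVolume.sum_volume_cubeSlab_div hd n hn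
  refine ⟨h, fun k hk => ?_⟩
  exact HypersimplexVolume.eq_of_sum_mul_choose_eq
    (v := fun p => HypersimplexVolume.relativeVolume x p)
    (w := fun p => (HypersimplexVolume.eulerianNumber d (p - 1) : ℝ))
    (fun n hn => (h n hn).trans (HypersimplexVolume.sum_eulerianNumber_mul hd n).symm)
    (Finset.mem_Icc.2 ⟨Nat.succ_pos k, hk⟩)
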